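/- Let $k$ be a field and let $H$ be a Hopf algebra over $k$. A right integral on $H$ is a linear functional $\chi : H \to k$ such that $\sum_{(a)} \chi(a_{(1)})\, a_{(2)} = \chi(a)\, 1_H$ for all $a \in H$. Let $H^* = \operatorname{Hom}_k(H,k)$ be the dual algebra, with the convolution product $(f * g)(h) = \sum_{(h)} f(h_{(1)})\, g(h_{(2)})$ and with the counit of $H$ as unit. If $H$ has a non-zero right integral, then $H^*$, regarded as a left module over itself by left multiplication, is an injective object of the category of left $H^*$-modules. -/

import Mathlib

open scoped TensorProduct

/-- The space of right integrals on a Hopf algebra `H` over a field `k`: linear functionals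
`χ : H → k` with `∑ χ(a₍₁₎) a₍₂₎ = χ(a) 1` for all `a`. -/
def rightIntegrals (k H : Type*) [Field k] [Ring H] [HopfAlgebra k H] :
    Submodule k (H →ₗ[k] k) where
  carrier := {χ | ∀ a : H,
    TensorProduct.lid k H (χ.rTensor H (Coalgebra.comul (R := k) a)) = χ a • (1 : H)}
  zero_mem' := by
    intro a
    simp
  add_mem' := by
    intro χ ψ hχ hψ a
    have h1 := hχ a
    have h2 := hψ a
    simp [LinearMap.rTensor_add, h1, h2, add_smul]
  smul_mem' := by
    intro c χ hχ a
    have h1 := hχ a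
    simp [LinearMap.rTensor_smul, h1, mul_smul]

/-- The dual algebra `H^*`: linear functionals on `H` with the convolution product
`(f * g)(h) = ∑ f(h₍₁₎) g(h₍₂₎)` and unit the counit of `H`. -/
abbrev ConvDual (k H : Type*) [Field k] [Ring H] [HopfAlgebra k H] : Type _ :=
  WithConv (H →ₗ[k] k)

open Coalgebra HopfAlgebra TensorProduct WithConv

namespace RightIntegral

variable {k H : Type*} [Field k] [Ring H] [HopfAlgebra k H]

/-! By Baer's criterion it suffices that each left linear `φ : J → H^*` is right multiplication by
some `r`, i.e. `φ f x = r (x ↼ f)`. Such an `r` exists if `∑ xᵢ ↼ gᵢ = 0` forces `∑ φ gᵢ xᵢ = 0`. A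
nonzero integral `χ` embeds `H` in `H^*` as a right module via `toDual χ` (`convMul_toDual`,
`toDual_injective`), and some `y` satisfies `y ↼ toDual χ xᵢ = xᵢ` for all `i`
(`exists_hit_toDual_eq`). Hence `∑ φ gᵢ xᵢ = φ (∑ toDual χ xᵢ * gᵢ) y = φ (toDual χ (∑ xᵢ ↼ gᵢ)) y =
0`. -/

/-- The right action `x ↼ f = ∑ f(x₍₁₎) x₍₂₎` of a functional `f` on `H`. -/
noncomputable def hit : (H →ₗ[k] k) →ₗ[k] H →ₗ[k] H :=
  (LinearMap.lcomp k H comul) ∘ₗ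
    (LinearMap.llcomp k (H ⊗[k] H) (k ⊗[k] H) H (TensorProduct.lid k H).toLinearMap) ∘ₗ
      LinearMap.rTensorHom H

lemma hit_apply (f : H →ₗ[k] k) (x : H) :
    hit f x = TensorProduct.lid k H (f.rTensor H (comul (R := k) x)) := rfl

lemma hit_eq_sum {ι : Type*} {x : H} (r : Coalgebra.Repr k x ι) (f : H →ₗ[k] k) :
    hit f x = ∑ i ∈ r.index, f (r.left i) • r.right i := by
  simp [hit_apply, ← r.eq]

lemma convMul_apply_eq (f g : ConvDual k H) (x : H) :
    (f * g) x = g (hit f.ofConv x) := by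
  rw [(ℛ k x).convMul_apply, hit_eq_sum (ℛ k x), map_sum]
  simp

/-- The linear map `x ↦ χ(S(x) ·)` from `H` to its dual. -/
noncomputable def toDual (χ : H →ₗ[k] k) : H →ₗ[k] H →ₗ[k] k :=
  (LinearMap.llcomp k H H k χ) ∘ₗ LinearMap.mul k H ∘ₗ antipode k

@[simp]
lemma toDual_apply (χ : H →ₗ[k] k) (x y : H) : toDual χ x y = χ (antipode k x * y) := rfl

/-- `∑ (1 ⊗ x₍₁₎) Δ(S(x₍₂₎)) = S(x) ⊗ 1`, in the convolution algebra of maps `H → H ⊗ H`. -/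
lemma includeRight_convMul_comul_antipode :
    (toConv (Algebra.TensorProduct.includeRight : H →ₐ[k] H ⊗[k] H).toLinearMap *
      toConv ((Bialgebra.comulAlgHom k H).toLinearMap ∘ₗ antipode k)) =
    toConv ((Algebra.TensorProduct.includeLeft : H →ₐ[k] H ⊗[k] H).toLinearMap ∘ₗ
      antipode k) := by
  set L : H →ₐ[k] H ⊗[k] H := Algebra.TensorProduct.includeLeft
  set R : H →ₐ[k] H ⊗[k] H := Algebra.TensorProduct.includeRight
  have hD : toConv L.toLinearMap * toConv R.toLinearMap =
      toConv (Bialgebra.comulAlgHom k H).toLinearMap := by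
    ext x
    rw [(ℛ k x).convMul_apply]
    simp [L, R, (ℛ k x).eq]
  have h1 : toConv (L.toLinearMap ∘ₗ antipode k) * toConv L.toLinearMap = 1 := by
    ext x
    rw [(ℛ k x).convMul_apply]
    have := congrArg L (sum_antipode_mul_eq_algebraMap_counit (ℛ k x))
    simpa using this
  have h2 : toConv (Bialgebra.comulAlgHom k H).toLinearMap *
      toConv ((Bialgebra.comulAlgHom k H).toLinearMap ∘ₗ antipode k) = 1 := by
    ext x
    rw [(ℛ k x).convMul_apply]
    have := congrArg (Bialgebra.comulAlgHom k H)
      (sum_mul_antipode_eq_algebraMap_counit (ℛ k x))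
    rw [map_sum, AlgHom.commutes] at this
    simpa using this
  calc _ = (toConv (L.toLinearMap ∘ₗ antipode k) * toConv L.toLinearMap) *
        (toConv R.toLinearMap *
          toConv ((Bialgebra.comulAlgHom k H).toLinearMap ∘ₗ antipode k)) := by
        rw [h1, one_mul]
    _ = _ := by rw [mul_assoc, ← mul_assoc (toConv L.toLinearMap), hD, h2, mul_one]

/-- `∑ χ(S(x) y₍₁₎) y₍₂₎ = ∑ χ(S(x₍₂₎) y) x₍₁₎` for a right integral `χ`. -/
lemma hit_toDual {χ : H →ₗ[k] k} (hχ : χ ∈ rightIntegrals k H) {ι : Type*} {x : H}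
    (r : Coalgebra.Repr k x ι) (y : H) :
    hit (toDual χ x) y = ∑ i ∈ r.index, toDual χ (r.right i) y • r.left i := by
  -- Multiply the identity by `Δ(y)` and apply `χ ⊗ id`; the integral property collapses `Δ(S(x₍₂₎)
  -- y)`.
  have key := congrArg (fun f : WithConv (H →ₗ[k] H ⊗[k] H) ↦
    TensorProduct.lid k H (χ.rTensor H (f x * comul (R := k) y)))
    (includeRight_convMul_comul_antipode (k := k) (H := H))
  simp only [r.convMul_apply, Finset.sum_mul, map_sum, mul_assoc] at key
  have pull (a : H) (t : H ⊗[k] H) : TensorProduct.lid k H (χ.rTensor H (1 ⊗ₜ[k] a * t)) =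
      a * TensorProduct.lid k H (χ.rTensor H t) := by
    induction t with
    | zero => simp
    | add s t hs ht => simp [mul_add, hs, ht]
    | tmul b c => simp
  have hl (s : H) : TensorProduct.lid k H (χ.rTensor H (s ⊗ₜ[k] 1 * comul (R := k) y)) =
      ∑ i ∈ (ℛ k y).index, χ (s * (ℛ k y).left i) • (ℛ k y).right i := by
    rw [← (ℛ k y).eq, Finset.mul_sum]
    simp
  have hr (a b : H) : TensorProduct.lid k H (χ.rTensor H
      (1 ⊗ₜ[k] a * (comul (R := k) b * comul (R := k) y))) = χ (b * y) • a := by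
    rw [pull, ← Bialgebra.comul_mul, hχ]
    simp
  rw [hit_eq_sum (ℛ k y)]
  simp only [toDual_apply]
  rw [← hl]
  refine Eq.trans key.symm (Finset.sum_congr rfl fun i _ ↦ ?_)
  exact hr _ _

lemma apply_hit_toDual {χ : H →ₗ[k] k} (hχ : χ ∈ rightIntegrals k H) (f : H →ₗ[k] k) (x y : H) :
    f (hit (toDual χ x) y) = toDual χ (hit f x) y := by
  rw [hit_toDual hχ (ℛ k x), hit_eq_sum (ℛ k x)]
  simp only [map_sum, map_smul, LinearMap.sum_apply, LinearMap.smul_apply, smul_eq_mul]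
  exact Finset.sum_congr rfl fun i _ ↦ mul_comm _ _

/-- The kernel is stable under `↼` and left multiplication, so it contains `∑ S(x₍₁₎) x₍₂₎ = ε(x) 1`
along with `x`. As `toDual χ 1 = χ ≠ 0`, `ε` vanishes on the kernel, whence `f x = ε (x ↼ f) = 0`
for every `f`. -/
lemma toDual_injective {χ : H →ₗ[k] k} (hχ : χ ∈ rightIntegrals k H) (h0 : χ ≠ 0) :
    Function.Injective (toDual χ) := by
  have hit_mem {x : H} (hx : toDual χ x = 0) (f : H →ₗ[k] k) : toDual χ (hit f x) = 0 := by
    ext y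
    rw [← apply_hit_toDual hχ, hx]
    simp
  have mul_mem (a : H) {x : H} (hx : toDual χ x = 0) : toDual χ (a * x) = 0 := by
    ext y
    rw [toDual_apply, antipode_mul_antidistrib, mul_assoc, ← toDual_apply, hx]
    simp
  have counit_eq {x : H} (hx : toDual χ x = 0) : counit (R := k) x = 0 := by
    -- With basis vectors as left legs of `Δ(x)`, each right leg is `x ↼ b.coord i`, hence in the
    -- kernel.
    let b := Module.Basis.ofVectorSpace k H
    obtain ⟨c, hc⟩ := TensorProduct.eq_repr_basis_left b (comul (R := k) x)
    have hcK (i) : toDual χ (c i) = 0 := by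
      have h := hit_mem hx (b.coord i)
      rw [hit_apply, ← hc] at h
      have hi : TensorProduct.lid k H ((b.coord i).rTensor H
          (c.sum fun j n ↦ b j ⊗ₜ[k] n)) = c i := by
        simp only [Finsupp.sum, map_sum, LinearMap.rTensor_tmul, TensorProduct.lid_tmul,
          Module.Basis.coord_apply, Module.Basis.repr_self]
        rw [Finset.sum_eq_single i (fun j _ hj ↦ by simp [Finsupp.single_eq_of_ne hj.symm])
          fun hi ↦ by simpa using hi]
        simp
      rwa [hi] at h
    have hs := mul_antipode_rTensor_comul_apply (R := k) x
    rw [← hc] at hs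
    simp only [Finsupp.sum, map_sum, LinearMap.rTensor_tmul, LinearMap.mul'_apply] at hs
    have h1 : toDual χ (algebraMap k H (counit (R := k) x)) = 0 := by
      rw [← hs, map_sum]
      exact Finset.sum_eq_zero fun i _ ↦ mul_mem _ (hcK i)
    by_contra hne
    apply h0
    ext y
    have := congrArg (fun g : H →ₗ[k] k ↦ g y) h1
    simpa [Algebra.algebraMap_eq_smul_one, hne] using this
  rw [injective_iff_map_eq_zero]
  intro x hx
  refine (Module.forall_dual_apply_eq_zero_iff k x).1 fun f ↦ ?_
  have h := convMul_apply_eq (toConv f) (1 : ConvDual k H) x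
  rw [mul_one, LinearMap.convOne_apply, counit_eq (hit_mem hx f), map_zero] at h
  exact h

/-- Every functional on a finite-dimensional subspace `D` of `H` has the form `x ↦ χ(S(x) y)`. -/
lemma exists_toDual_eq {χ : H →ₗ[k] k} (hχ : χ ∈ rightIntegrals k H) (h0 : χ ≠ 0)
    (D : Submodule k H) [FiniteDimensional k D] (f : H →ₗ[k] k) :
    ∃ y, ∀ d ∈ D, toDual χ d y = f d := by
  let T : H →ₗ[k] Module.Dual k D := LinearMap.flip (toDual χ ∘ₗ D.subtype)
  have hT : LinearMap.range T = ⊤ := by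
    rw [← Subspace.dualCoannihilator_dualAnnihilator_eq (W := LinearMap.range T)]
    have : (LinearMap.range T).dualCoannihilator = ⊥ := by
      rw [eq_bot_iff]
      intro d hd
      rw [Submodule.mem_dualCoannihilator] at hd
      have hd0 : toDual χ (d : H) = 0 := by
        ext y
        exact hd _ ⟨y, rfl⟩
      rw [Submodule.mem_bot]
      exact Subtype.ext (toDual_injective hχ h0 (hd0.trans (map_zero _).symm))
    rw [this, Submodule.dualAnnihilator_bot]
  obtain ⟨y, hy⟩ := LinearMap.range_eq_top.1 hT (f ∘ₗ D.subtype)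
  exact ⟨y, fun d hd ↦ LinearMap.congr_fun hy ⟨d, hd⟩⟩

lemma exists_hit_toDual_eq {χ : H →ₗ[k] k} (hχ : χ ∈ rightIntegrals k H) (h0 : χ ≠ 0)
    {ι : Type*} [Finite ι] (x : ι → H) : ∃ y, ∀ i, hit (toDual χ (x i)) y = x i := by
  let A : ι → Set H := fun i ↦ (ℛ k (x i)).right '' (ℛ k (x i)).index
  have hA : (⋃ i, A i).Finite := Set.finite_iUnion fun i ↦ (Finset.finite_toSet _).image _
  have : FiniteDimensional k (Submodule.span k (⋃ i, A i)) :=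
    FiniteDimensional.span_of_finite k hA
  -- Making `toDual χ · y` agree with `ε` on the right legs reduces `hit_toDual` to the counit
  -- axiom.
  obtain ⟨y, hy⟩ := exists_toDual_eq hχ h0 (Submodule.span k (⋃ i, A i)) counit
  refine ⟨y, fun i ↦ ?_⟩
  rw [hit_toDual hχ (ℛ k (x i))]
  have h := congrArg (TensorProduct.rid k H) (sum_tmul_counit_eq (R := k) (ℛ k (x i)))
  simp only [map_sum, TensorProduct.rid_tmul, one_smul] at h
  refine Eq.trans (Finset.sum_congr rfl fun j hj ↦ ?_) h
  rw [hy _ (Submodule.subset_span (Set.mem_iUnion.2 ⟨i, j, hj, rfl⟩))]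

lemma convMul_toDual {χ : H →ₗ[k] k} (hχ : χ ∈ rightIntegrals k H) (x : H) (f : ConvDual k H) :
    toConv (toDual χ x) * f = toConv (toDual χ (hit f.ofConv x)) := by
  ext y
  rw [convMul_apply_eq]
  exact apply_hit_toDual hχ _ _ _

/-- A relation `∑ xᵢ ↼ gᵢ = 0` with `gᵢ` in a left ideal is respected by left linear maps. -/
lemma sum_apply_eq_zero {χ : H →ₗ[k] k} (hχ : χ ∈ rightIntegrals k H) (h0 : χ ≠ 0)
    (J : Ideal (ConvDual k H)) (φ : J →ₗ[ConvDual k H] ConvDual k H)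
    {ι : Type*} [Fintype ι] (x : ι → H) (g : ι → J)
    (h : ∑ i, hit (g i : ConvDual k H).ofConv (x i) = 0) : ∑ i, φ (g i) (x i) = 0 := by
  obtain ⟨y, hy⟩ := exists_hit_toDual_eq hχ h0 x
  have hsum : ∑ i, toConv (toDual χ (x i)) • g i = 0 := by
    apply Subtype.ext
    rw [AddSubmonoidClass.coe_finsetSum]
    simp only [SetLike.val_smul, smul_eq_mul, convMul_toDual hχ]
    rw [← toConv_sum, ← map_sum, h]
    simp
  have := congrArg (fun f : ConvDual k H ↦ f y) (congrArg φ hsum)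
  simp only [map_sum, map_smul, smul_eq_mul, map_zero, ofConv_sum, LinearMap.sum_apply,
    convMul_apply_eq, hy] at this
  simpa using this

/-- A bilinear map `c` factors through a bilinear map `b` if it satisfies all relations of `b`. -/
lemma exists_comp_eq_of_forall_sum_eq_zero {V W U M : Type*} [AddCommGroup V] [AddCommGroup W]
    [AddCommGroup U] [AddCommGroup M] [Module k V] [Module k W] [Module k U] [Module k M]
    (b : V →ₗ[k] W →ₗ[k] U) (c : V →ₗ[k] W →ₗ[k] M)
    (h : ∀ (n : ℕ) (v : Fin n → V) (w : Fin n → W),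
      ∑ i, b (v i) (w i) = 0 → ∑ i, c (v i) (w i) = 0) :
    ∃ r : U →ₗ[k] M, ∀ v w, r (b v w) = c v w := by
  let F := TensorProduct.lift b
  have hFG : LinearMap.ker F ≤ LinearMap.ker (TensorProduct.lift c) := by
    intro t ht
    obtain ⟨n, v, w, rfl⟩ := TensorProduct.exists_sum_tmul_eq t
    rw [LinearMap.mem_ker, map_sum] at ht ⊢
    exact h n v w ht
  obtain ⟨r, hr⟩ := LinearMap.exists_extend
    ((LinearMap.ker F).liftQ _ hFG ∘ₗ F.quotKerEquivRange.symm.toLinearMap)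
  refine ⟨r, fun v w ↦ ?_⟩
  simpa [F] using
    LinearMap.congr_fun hr (F.quotKerEquivRange (Submodule.Quotient.mk (v ⊗ₜ w)))

lemma baer {χ : H →ₗ[k] k} (hχ : χ ∈ rightIntegrals k H) (h0 : χ ≠ 0) :
    Module.Baer (ConvDual k H) (ConvDual k H) := by
  intro J φ
  let e : ConvDual k H →ₗ[k] H →ₗ[k] k := (WithConv.linearEquiv k (H →ₗ[k] k)).toLinearMap
  let i : J →ₗ[k] ConvDual k H := J.subtype.restrictScalars k
  let ψ : J →ₗ[k] ConvDual k H := φ.restrictScalars k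
  obtain ⟨r, hr⟩ := exists_comp_eq_of_forall_sum_eq_zero (hit ∘ₗ e ∘ₗ i) (e ∘ₗ ψ)
    fun n g x ↦ sum_apply_eq_zero hχ h0 J φ x g
  refine ⟨LinearMap.toSpanSingleton _ _ (toConv r), fun f hf ↦ WithConv.ext ?_⟩
  exact LinearMap.ext fun x ↦ (convMul_apply_eq f (toConv r) x).trans (hr ⟨f, hf⟩ x)

end RightIntegral

theorem mainTheorem6 (k H : Type*) [Field k] [Ring H] [HopfAlgebra k H]
    (hH : ∃ χ ∈ rightIntegrals k H, χ ≠ 0) :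
    Module.Injective (ConvDual k H) (ConvDual k H) := by
  obtain ⟨χ, hχ, h0⟩ := hH
  exact (RightIntegral.baer hχ h0).injective
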